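/- Throughout, theories are complete first-order theories, structures are nonempty, and $n\ge 2$ is an integer. An $n$-formula of $T$ is a formula that is $T$-equivalent to a Boolean combination of formulas in $n$ free variables. The theory $T$ is *almost $n$-ary* if there are finitely many formulas $\varphi_1(\overline x),\dots,\varphi_m(\overline x)$ such that every formula is $T$-equivalent to a Boolean combination of $n$-formulas and of formulas obtained from $\varphi_1,\dots,\varphi_m$ by substitutions of free variables. It is *almost $n$-aritizable* if some expansion of $T$ to a larger language is almost $n$-ary. Let $\mathcal M,\mathcal N$ be structures of relational languages $\Sigma_{\mathcal M},\Sigma_{\mathcal N}$, which may share symbols. The composition $\mathcal M[\mathcal N]$ is the structure of language $\Sigma_{\mathcal M}\cup\Sigma_{\mathcal N}$ with universe $M\times N$ in which a $k$-ary symbol $R$ holds of $((a_1,b_1),\dots,(a_k,b_k))$ iff * (outer part) $R\in\Sigma_{\mathcal M}$ and $\mathcal M\models R(a_1,\dots,a_k)$, or * (inner part) $R\in\Sigma_{\mathcal N}$, $a_1=\dots=a_k$ and $\mathcal N\models R(b_1,\dots,b_k)$. A composition $T_1[T_2]$ of theories is $\mathrm{Th}(\mathcal M[\mathcal N])$ for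 some $\mathcal M\models T_1$, $\mathcal N\models T_2$. The composition is *$E$-definable* if the equivalence relation $E=\{((a,b),(a',b')) : a=a'\}$ is $\emptyset$-definable in $\mathcal M[\mathcal N]$. It *separates the common symbols* if for every $R\in\Sigma_{\mathcal M}\cap\Sigma_{\mathcal N}$ both the outer part and the inner part of $R$ are $\emptyset$-definable in $\mathcal M[\mathcal N]$ (this is vacuous when the languages are disjoint). A composition of finitely many theories $T_1,\dots,T_m$ ($m\ge1$) is any theory obtained from them, in this order and with any bracketing, by iterating the binary composition. **Corollary.** Let $n\ge 2$. 1. If $T_1,\dots,T_m$ are almost $n$-ary, then every composition of $T_1,\dots,T_m$ in which each binary step is $E$-definable and separates the common symbols is almost $n$-ary. 2. If $T_1,\dots,T_m$ are almost $n$-aritizable, then every composition of $T_1,\dots,T_m$ is almost $n$-aritizable. -/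

import Mathlib

open FirstOrder FirstOrder.Language

universe u v

namespace AlmostArity

/-! ### Almost `n`-ary and almost `n`-aritizable theories -/

section Arity

/-- The Boolean combinations of the formulas in `Δ`. Variables are indexed by `ℕ`. -/
inductive BoolComb {L : FirstOrder.Language.{u, v}} (Δ : Set (L.Formula ℕ)) : L.Formula ℕ → Prop
  | of (φ : L.Formula ℕ) (h : φ ∈ Δ) : BoolComb Δ φ
  | not (φ : L.Formula ℕ) (h : BoolComb Δ φ) : BoolComb Δ φ.not
  | and (φ ψ : L.Formula ℕ) (h : BoolComb Δ φ) (h' : BoolComb Δ ψ) : BoolComb Δ (φ ⊓ ψ)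
  | or (φ ψ : L.Formula ℕ) (h : BoolComb Δ φ) (h' : BoolComb Δ ψ) : BoolComb Δ (φ ⊔ ψ)

/-- The formulas obtained from `φ(x₁, …, x_k)` by substituting variables for `x₁, …, x_k`. -/
def substInstances {L : FirstOrder.Language.{u, v}} {k : ℕ} (φ : L.Formula (Fin k)) :
    Set (L.Formula ℕ) :=
  {ψ | ∃ f : Fin k → ℕ, ψ = φ.relabel f}

/-- `φ` is an `n`-formula of `T`: it is `T`-equivalent to a Boolean combination of formulas
in `n` free variables. -/
def IsNFormula {L : FirstOrder.Language.{u, v}} (T : L.Theory) (n : ℕ) (φ : L.Formula ℕ) : Prop :=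
  ∃ ψ : L.Formula ℕ, BoolComb (⋃ χ : L.Formula (Fin n), substInstances χ) ψ ∧ (φ ⇔[T] ψ)

/-- `T` is almost `n`-ary: for some finite list of formulas `φ₁(x̄), …, φ_m(x̄)`, every formula is
`T`-equivalent to a Boolean combination of `n`-formulas and of formulas obtained from the `φᵢ` by
substitutions of free variables. -/
def AlmostNAry {L : FirstOrder.Language.{u, v}} (n : ℕ) (T : L.Theory) : Prop :=
  ∃ (m k : ℕ) (φ : Fin m → L.Formula (Fin k)), ∀ χ : L.Formula ℕ, ∃ ψ : L.Formula ℕ,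
    BoolComb ({θ | IsNFormula T n θ} ∪ ⋃ i, substInstances (φ i)) ψ ∧ (χ ⇔[T] ψ)

/-- `T` is almost `n`-aritizable: some (complete) expansion of `T`, in a language with arbitrary
additional symbols, is almost `n`-ary. -/
def AlmostNAritizable {L : FirstOrder.Language.{u, v}} (n : ℕ) (T : L.Theory) : Prop :=
  ∃ (L' : FirstOrder.Language.{max u v, max u v}) (T' : (L.sum L').Theory),
    T'.IsComplete ∧ (LHom.sumInl : L →ᴸ L.sum L').onTheory T ⊆ T' ∧ AlmostNAry n T'

end Arity

/-! ### Compositions of structures -/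

section Composition

/-- A relational signature: a set of relation symbols, where `S k` is the ambient type of
`k`-ary relation symbols. Different signatures may share symbols. -/
abbrev Signature (S : ℕ → Type u) : Type u := ∀ k, Set (S k)

/-- The relational language with the symbols in `σ`. -/
def Signature.lang {S : ℕ → Type u} (σ : Signature S) : FirstOrder.Language.{u, u} where
  Functions _ := PEmpty.{u + 1}
  Relations k := {R : S k // R ∈ σ k}

/-- The union of two signatures. -/
abbrev Signature.union {S : ℕ → Type u} (σ τ : Signature S) : Signature S :=
  fun k => σ k ∪ τ k

variable {S : ℕ → Type u} (σ τ : Signature S) (M N : Type u)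
  [σ.lang.Structure M] [τ.lang.Structure N]

/-- The relation on `M × N` that a symbol of the signature of `M` contributes: it holds of
`((a₁, b₁), …, (a_k, b_k))` iff `R` holds of `(a₁, …, a_k)` in `M`. -/
def outerRel {k : ℕ} (R : σ.lang.Relations k) : Set (Fin k → M × N) :=
  {x | Structure.RelMap R fun i => (x i).1}

/-- The relation on `M × N` that a symbol of the signature of `N` contributes: it holds of
`((a₁, b₁), …, (a_k, b_k))` iff `a₁ = … = a_k` and `R` holds of `(b₁, …, b_k)` in `N`. -/
def innerRel {k : ℕ} (R : τ.lang.Relations k) : Set (Fin k → M × N) :=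
  {x | (∀ i j, (x i).1 = (x j).1) ∧ Structure.RelMap R fun i => (x i).2}

/-- The composition `M[N]`, with universe `M × N` and the union of both signatures. -/
@[reducible]
def compStructure : (σ.union τ).lang.Structure (M × N) where
  funMap f := PEmpty.elim f
  RelMap {k} R x :=
    (∃ h : R.1 ∈ σ k, x ∈ outerRel σ M N ⟨R.1, h⟩) ∨
      (∃ h : R.1 ∈ τ k, x ∈ innerRel τ M N ⟨R.1, h⟩)

/-- A symbol of `M` that is not a symbol of `N`. -/
theorem relMap_comp_of_left {k : ℕ} (R : S k) (hσ : R ∈ σ k) (hτ : R ∉ τ k)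
    (x : Fin k → M × N) :
    (compStructure σ τ M N).RelMap ⟨R, Or.inl hσ⟩ x ↔
      Structure.RelMap (L := σ.lang) ⟨R, hσ⟩ fun i => (x i).1 := by
  constructor
  · rintro (⟨_, h⟩ | ⟨h, _⟩)
    · exact h
    · exact absurd h hτ
  · exact fun h => Or.inl ⟨hσ, h⟩

/-- A symbol of `N` that is not a symbol of `M`. -/
theorem relMap_comp_of_right {k : ℕ} (R : S k) (hσ : R ∉ σ k) (hτ : R ∈ τ k)
    (x : Fin k → M × N) :
    (compStructure σ τ M N).RelMap ⟨R, Or.inr hτ⟩ x ↔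
      (∀ i j, (x i).1 = (x j).1) ∧
        Structure.RelMap (L := τ.lang) ⟨R, hτ⟩ fun i => (x i).2 := by
  constructor
  · rintro (⟨h, _⟩ | ⟨_, h⟩)
    · exact absurd h hσ
    · exact h
  · exact fun h => Or.inr ⟨hτ, h⟩

/-- A common symbol of `M` and `N`. -/
theorem relMap_comp_of_both {k : ℕ} (R : S k) (hσ : R ∈ σ k) (hτ : R ∈ τ k)
    (x : Fin k → M × N) :
    (compStructure σ τ M N).RelMap ⟨R, Or.inl hσ⟩ x ↔
      (Structure.RelMap (L := σ.lang) ⟨R, hσ⟩ fun i => (x i).1) ∨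
      ((∀ i j, (x i).1 = (x j).1) ∧
        Structure.RelMap (L := τ.lang) ⟨R, hτ⟩ fun i => (x i).2) := by
  constructor
  · rintro (⟨_, h⟩ | ⟨_, h⟩)
    · exact Or.inl h
    · exact Or.inr h
  · rintro (h | h)
    · exact Or.inl ⟨hσ, h⟩
    · exact Or.inr ⟨hτ, h⟩

/-- A subset of `(M × N)^α` is `∅`-definable in `M[N]`. -/
def DefinableInComp {α : Type} (s : Set (α → M × N)) : Prop :=
  letI := compStructure σ τ M N
  (∅ : Set (M × N)).Definable (σ.union τ).lang s

/-- `M[N]` is `E`-definable: the equivalence relation whose classes are the universes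
`{a} × N` of the copies of `N` is `∅`-definable in `M[N]`. -/
def IsEDefinable : Prop :=
  DefinableInComp σ τ M N {x : Fin 2 → M × N | (x 0).1 = (x 1).1}

/-- For every common symbol `R` of `M` and `N`, whose interpretation in `M[N]` is the union of
the two relations contributed by `M` and by `N`, both of these relations are `∅`-definable in
`M[N]`. This holds vacuously if the signatures are disjoint. -/
def SeparatesCommonSymbols : Prop :=
  ∀ (k : ℕ) (R : S k) (hσ : R ∈ σ k) (hτ : R ∈ τ k),
    DefinableInComp σ τ M N (outerRel σ M N ⟨R, hσ⟩) ∧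
      DefinableInComp σ τ M N (innerRel τ M N ⟨R, hτ⟩)

end Composition

/-! ### Compositions of theories -/

section Theories

/-- A complete theory in a relational signature. -/
structure RelTheory (S : ℕ → Type u) where
  sig : Signature S
  theory : sig.lang.Theory
  complete : theory.IsComplete

/-- The complete theory `Th(M)` of a nonempty structure. -/
def RelTheory.ofStructure {S : ℕ → Type u} (σ : Signature S) (M : Type u)
    [σ.lang.Structure M] [Nonempty M] : RelTheory S where
  sig := σ
  theory := σ.lang.completeTheory M
  complete := (completeTheory.isMaximal σ.lang M).isComplete

/-- The theory `Th(M[N])`. -/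
def RelTheory.ofComp {S : ℕ → Type u} (σ τ : Signature S) (M N : Type u)
    [σ.lang.Structure M] [τ.lang.Structure N] [Nonempty M] [Nonempty N] : RelTheory S :=
  letI := compStructure σ τ M N
  RelTheory.ofStructure (σ.union τ) (M × N)

/-- `T` is the composition `T₁[T₂]`, i.e. `T = Th(M[N])` where `M ⊨ T₁` and `N ⊨ T₂`. -/
def IsComp {S : ℕ → Type u} (T₁ T₂ T : RelTheory S) : Prop :=
  ∃ (M N : Type u) (_ : T₁.sig.lang.Structure M) (_ : T₂.sig.lang.Structure N)
    (_ : Nonempty M) (_ : Nonempty N),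
    M ⊨ T₁.theory ∧ N ⊨ T₂.theory ∧ T = RelTheory.ofComp T₁.sig T₂.sig M N

/-- `T` is the composition `T₁[T₂]`, and this composition is `E`-definable and separates the
common symbols. -/
def IsEDefComp {S : ℕ → Type u} (T₁ T₂ T : RelTheory S) : Prop :=
  ∃ (M N : Type u) (_ : T₁.sig.lang.Structure M) (_ : T₂.sig.lang.Structure N)
    (_ : Nonempty M) (_ : Nonempty N),
    M ⊨ T₁.theory ∧ N ⊨ T₂.theory ∧ T = RelTheory.ofComp T₁.sig T₂.sig M N ∧
      IsEDefinable T₁.sig T₂.sig M N ∧ SeparatesCommonSymbols T₁.sig T₂.sig M N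

/-- `FiniteComp comp l T`: the theory `T` is obtained from the theories in the nonempty finite
list `l`, in this order and with an arbitrary bracketing, by iterating the binary composition
`comp`. -/
inductive FiniteComp {S : ℕ → Type u} (comp : RelTheory S → RelTheory S → RelTheory S → Prop) :
    List (RelTheory S) → RelTheory S → Prop
  | single (T : RelTheory S) : FiniteComp comp [T] T
  | comp (l₁ l₂ : List (RelTheory S)) (T₁ T₂ T : RelTheory S)
      (h₁ : FiniteComp comp l₁ T₁) (h₂ : FiniteComp comp l₂ T₂) (h : comp T₁ T₂ T) :
      FiniteComp comp (l₁ ++ l₂) T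

end Theories

end AlmostArity

/-!
Every formula of `M[N]` is a Boolean combination of outer predicates (a definable predicate of `M`
holds of the first coordinates) and inner predicates (some variables share their first coordinate,
and their second coordinates satisfy a definable predicate of `N`). For the existential quantifier
this is a finite back-and-forth: the first coordinate of the new element is chosen in `M`, and then
its second coordinate in `N`, relative to the variables with the same first coordinate.

Conversely, if `E` and the outer and inner parts of all symbols are definable, then so are all outer
and inner predicates, and they depend on the same variables as the predicates of `M` and `N` they
come from. So finitely many formulas that generate those of `M` and of `N` yield finitely many that
generate those of `M[N]`.

For aritizability, replace `M` and `N` by models of the almost `n`-ary expansions, which does not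
change the theory of the composition, and expand `M[N]` by all outer and inner predicates that come
from these expansions.
-/

namespace AlmostArity

/-! ### Boolean algebras of predicates on assignments -/

section Predicates

open Function
open BooleanSubalgebra hiding closure subset_closure

variable {I : Type*} {X Y : I → Type*}

/-- A predicate on the assignments of the variables `ℕ` in the members of a family of types. The
family lets one predicate compare assignments in different structures. -/
abbrev UniformPred (X : I → Type*) := ∀ i, (ℕ → X i) → Prop

namespace UniformPred

/-- The predicate `∃ xⱼ, p`. -/
def ex (j : ℕ) (p : UniformPred X) : UniformPred X := fun i v => ∃ a, p i (update v j a)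

variable (X) in
/-- The predicate `xⱼ = xₖ`. -/
def eqVar (j k : ℕ) : UniformPred X := fun _ v => v j = v k

/-- The pullback of predicates along maps of assignments. -/
def comap (g : ∀ i, (ℕ → Y i) → ℕ → X i) : BoundedLatticeHom (UniformPred X) (UniformPred Y) where
  toFun p i v := p i (g i v)
  map_sup' _ _ := rfl
  map_inf' _ _ := rfl
  map_top' := rfl
  map_bot' := rfl

/-- The substitution of `x_{f k}` for the variable `x_k`. -/
abbrev subst (f : ℕ → ℕ) : BoundedLatticeHom (UniformPred X) (UniformPred X) :=
  comap fun _ v => v ∘ f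

variable (X) in
/-- The predicates that only depend on the variables in `D`. -/
def dependingOn (D : Set ℕ) : BooleanSubalgebra (UniformPred X) where
  carrier := {p | ∀ i, DependsOn (p i) D}
  supClosed' _ hp _ hq i _ _ h := congrArg₂ Or (hp i h) (hq i h)
  infClosed' _ hp _ hq i _ _ h := congrArg₂ And (hp i h) (hq i h)
  compl_mem' hp i _ _ h := congrArg Not (hp i h)
  bot_mem' _ _ _ _ := rfl

theorem dependingOn_mono {D D' : Set ℕ} (h : D ⊆ D') : dependingOn X D ≤ dependingOn X D' :=
  fun _ hp i => (hp i).mono h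

theorem ex_mem_dependingOn {j : ℕ} {D : Set ℕ} {p : UniformPred X}
    (hp : p ∈ dependingOn X (insert j D)) :
    ex j p ∈ dependingOn X D := by
  refine fun i v v' h => congrArg Exists (funext fun a => hp i fun k hk => ?_)
  rcases eq_or_ne k j with rfl | hkj
  · simp only [update_self]
  · simp only [update_of_ne hkj, h k (hk.resolve_left hkj)]

theorem subst_mem_dependingOn {f : ℕ → ℕ} {D : Set ℕ} {p : UniformPred X}
    (hp : p ∈ dependingOn X D) : subst f p ∈ dependingOn X (f '' D) :=
  fun i _ _ h => hp i fun k hk => h (f k) (Set.mem_image_of_mem f hk)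

/-- The predicate holding of the assignments that satisfy exactly the predicates of `𝒮` among
those of `𝒯`. -/
def exactly (𝒯 𝒮 : Set (UniformPred X)) : UniformPred X := (⨅ p ∈ 𝒮, p) ⊓ ⨅ p ∈ 𝒯 \ 𝒮, pᶜ

/-- The assignments `v` and `v'` satisfy the same predicates of `𝒯`. -/
def SameType (𝒯 : Set (UniformPred X)) {i i' : I} (v : ℕ → X i) (v' : ℕ → X i') : Prop :=
  ∀ p ∈ 𝒯, p i v ↔ p i' v'

theorem SameType.mono {𝒯 𝒯' : Set (UniformPred X)} (h𝒯 : 𝒯' ⊆ 𝒯) {i i' : I} {v : ℕ → X i}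
    {v' : ℕ → X i'} (h : SameType 𝒯 v v') : SameType 𝒯' v v' :=
  fun p hp => h p (h𝒯 hp)

variable {A B : BooleanSubalgebra (UniformPred X)} {𝒯 : Set (UniformPred X)}

theorem exactly_mem (hfin : 𝒯.Finite) (h𝒯 : 𝒯 ⊆ A) {𝒮 : Set (UniformPred X)} (h𝒮 : 𝒮 ⊆ 𝒯) :
    exactly 𝒯 𝒮 ∈ A :=
  inf_mem (biInf_mem (hfin.subset h𝒮) fun _ hp => h𝒯 (h𝒮 hp))
    (biInf_mem hfin.sdiff fun _ hp => compl_mem (h𝒯 hp.1))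

theorem exactly_setOf (i : I) (v : ℕ → X i) : exactly 𝒯 {p ∈ 𝒯 | p i v} i v := by
  simp +contextual [exactly]

theorem sameType_of_exactly {𝒮 : Set (UniformPred X)} {i i' : I} {v : ℕ → X i} {v' : ℕ → X i'}
    (h : exactly 𝒯 𝒮 i v) (h' : exactly 𝒯 𝒮 i' v') : SameType 𝒯 v v' := by
  simp only [exactly, Pi.inf_apply, iInf_apply, iInf_Prop_eq, inf_Prop_eq, Pi.compl_apply,
    compl_iff_not] at h h'
  intro p hp
  by_cases hpS : p ∈ 𝒮
  · exact iff_of_true (h.1 p hpS) (h'.1 p hpS)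
  · exact iff_of_false (h.2 p ⟨hp, hpS⟩) (h'.2 p ⟨hp, hpS⟩)

theorem mem_of_forall_sameType (hfin : 𝒯.Finite) (h𝒯 : 𝒯 ⊆ A) {s : UniformPred X}
    (hs : ∀ i i' (v : ℕ → X i) (v' : ℕ → X i'), SameType 𝒯 v v' → s i v → s i' v') : s ∈ A := by
  have : s = ⨆ 𝒮 ∈ {𝒮 ∈ 𝒯.powerset | ∃ i v, s i v ∧ exactly 𝒯 𝒮 i v}, exactly 𝒯 𝒮 := by
    ext i v
    simp only [iSup_apply, iSup_Prop_eq]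
    refine ⟨fun h => ⟨_, ⟨Set.sep_subset _ _, i, v, h, exactly_setOf i v⟩, exactly_setOf i v⟩, ?_⟩
    rintro ⟨𝒮, ⟨-, i', v', hs', h'⟩, h⟩
    exact hs i' i v' v (sameType_of_exactly h' h) hs'
  rw [this]
  exact biSup_mem (hfin.powerset.subset (Set.sep_subset _ _)) fun 𝒮 h𝒮 => exactly_mem hfin h𝒯 h𝒮.1

theorem exists_finite_sameType_of_mem_closure {𝒢 : Set (UniformPred X)} {s : UniformPred X}
    (hs : s ∈ BooleanSubalgebra.closure 𝒢) : ∃ 𝒯 ⊆ 𝒢, 𝒯.Finite ∧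
      ∀ i i' (v : ℕ → X i) (v' : ℕ → X i'), SameType 𝒯 v v' → (s i v ↔ s i' v') := by
  induction hs using closure_bot_sup_induction with
  | mem p hp => exact ⟨{p}, by simpa using hp, Set.finite_singleton p, fun _ _ _ _ h => h p rfl⟩
  | bot => exact ⟨∅, Set.empty_subset _, Set.finite_empty, fun _ _ _ _ _ => Iff.rfl⟩
  | sup p _ q _ ihp ihq =>
    obtain ⟨𝒯, h𝒯, hfin, hp⟩ := ihp
    obtain ⟨𝒯', h𝒯', hfin', hq⟩ := ihq
    exact ⟨𝒯 ∪ 𝒯', Set.union_subset h𝒯 h𝒯', hfin.union hfin', fun i i' v v' h =>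
      or_congr (hp i i' v v' (h.mono Set.subset_union_left))
        (hq i i' v v' (h.mono Set.subset_union_right))⟩
  | compl p _ ih =>
    obtain ⟨𝒯, h𝒯, hfin, h⟩ := ih
    exact ⟨𝒯, h𝒯, hfin, fun i i' v v' hv => not_congr (h i i' v v' hv)⟩

theorem exists_finite_backAndForth {j : ℕ} (hAB : ∀ p ∈ A, ex j p ∈ B) (hfin : 𝒯.Finite)
    (h𝒯 : 𝒯 ⊆ A) : ∃ 𝒯' : Set (UniformPred X), 𝒯'.Finite ∧ 𝒯' ⊆ B ∧
      ∀ i i' (v : ℕ → X i) (v' : ℕ → X i'), SameType 𝒯' v v' →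
        ∀ a, ∃ a', SameType 𝒯 (update v j a) (update v' j a') := by
  refine ⟨(ex j ∘ exactly 𝒯) '' 𝒯.powerset, hfin.powerset.image _, ?_, fun i i' v v' h a => ?_⟩
  · rintro _ ⟨𝒮, h𝒮, rfl⟩
    exact hAB _ (exactly_mem hfin h𝒯 h𝒮)
  · obtain ⟨a', ha'⟩ := (h _ ⟨{p ∈ 𝒯 | p i (update v j a)}, Set.sep_subset _ _, rfl⟩).1
      ⟨a, exactly_setOf i _⟩
    exact ⟨a', sameType_of_exactly (exactly_setOf i _) ha'⟩

theorem ex_mem_closure {𝒢 : Set (UniformPred X)} {j : ℕ}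
    (h𝒢 : ∀ 𝒯 ⊆ 𝒢, 𝒯.Finite → ∃ 𝒯' ⊆ 𝒢, 𝒯'.Finite ∧
      ∀ i i' (v : ℕ → X i) (v' : ℕ → X i'), SameType 𝒯' v v' →
        ∀ a, ∃ a', SameType 𝒯 (update v j a) (update v' j a'))
    {s : UniformPred X} (hs : s ∈ BooleanSubalgebra.closure 𝒢) :
    ex j s ∈ BooleanSubalgebra.closure 𝒢 := by
  obtain ⟨𝒯, h𝒯, hfin, hs⟩ := exists_finite_sameType_of_mem_closure hs
  obtain ⟨𝒯', h𝒯', hfin', hback⟩ := h𝒢 𝒯 h𝒯 hfin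
  refine mem_of_forall_sameType hfin' (h𝒯'.trans BooleanSubalgebra.subset_closure) ?_
  rintro i i' v v' h ⟨a, ha⟩
  obtain ⟨a', ha'⟩ := hback i i' v v' h a
  exact ⟨a', (hs _ _ _ _ ha').1 ha⟩

end UniformPred

end Predicates

/-! ### Definable predicates -/

section Definable

open Function BooleanSubalgebra UniformPred

variable {L : FirstOrder.Language} {I : Type*} {X : I → Type*} [∀ i, L.Structure (X i)]

variable (X) in
/-- The predicate defined by the formula `φ` in all the structures `X i`. -/
def den (φ : L.Formula ℕ) : UniformPred X := fun _ v => φ.Realize v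

variable (L X) in
/-- The predicates that are defined by one formula in all the structures `X i`. -/
def definable : BooleanSubalgebra (UniformPred X) where
  carrier := Set.range (den (L := L) X)
  supClosed' := by
    rintro _ ⟨φ, rfl⟩ _ ⟨ψ, rfl⟩
    exact ⟨φ ⊔ ψ, by ext; exact Formula.realize_sup⟩
  infClosed' := by
    rintro _ ⟨φ, rfl⟩ _ ⟨ψ, rfl⟩
    exact ⟨φ ⊓ ψ, by ext; exact Formula.realize_inf⟩
  compl_mem' := by
    rintro _ ⟨φ, rfl⟩
    exact ⟨φ.not, by ext; exact Formula.realize_not⟩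
  bot_mem' := ⟨⊥, by ext; exact Formula.realize_bot⟩

variable (L X) in
/-- The definable predicates that only depend on the variables in `D`. They need not be defined by
a formula with free variables in `D`, but see `exists_formula_of_mem_definableOn_range`. -/
def definableOn (D : Set ℕ) : BooleanSubalgebra (UniformPred X) :=
  definable L X ⊓ dependingOn X D

theorem realize_comp_mem_definable {α : Type*} (φ : L.Formula α) (f : α → ℕ) :
    (fun _ v => φ.Realize (v ∘ f)) ∈ definable L X :=
  ⟨φ.relabel f, by ext; exact Formula.realize_relabel⟩

theorem realize_comp_mem_definableOn {α : Type*} (φ : L.Formula α) (f : α → ℕ) :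
    (fun _ v => φ.Realize (v ∘ f)) ∈ definableOn L X (Set.range f) :=
  ⟨realize_comp_mem_definable φ f, fun _ _ _ h => congrArg φ.Realize (funext fun a => h _ ⟨a, rfl⟩)⟩

theorem subst_mem_definable {p : UniformPred X} (hp : p ∈ definable L X) (f : ℕ → ℕ) :
    subst f p ∈ definable L X := by
  obtain ⟨φ, rfl⟩ := hp
  exact realize_comp_mem_definable φ f

theorem definable_le_of_isExpansionOn {L' : FirstOrder.Language} [∀ i, L'.Structure (X i)]
    (φ : L →ᴸ L') [∀ i, φ.IsExpansionOn (X i)] : definable L X ≤ definable L' X := by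
  rintro _ ⟨ψ, rfl⟩
  exact ⟨φ.onFormula ψ, by ext; exact φ.realize_onFormula ψ⟩

theorem eq_mem_definable (j k : ℕ) : eqVar X j k ∈ definable L X :=
  ⟨Term.equal (Term.var j) (Term.var k), by ext; simp [den, eqVar, Formula.realize_equal]⟩

theorem relMap_mem_definable {k : ℕ} (R : L.Relations k) (f : Fin k → ℕ) :
    (fun _ v => Structure.RelMap R (v ∘ f)) ∈ definable L X :=
  ⟨R.formula fun i => Term.var (f i), by ext; exact Formula.realize_rel⟩

theorem ex_mem_definable {p : UniformPred X} (j : ℕ) (hp : p ∈ definable L X) :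
    ex j p ∈ definable L X := by
  obtain ⟨φ, rfl⟩ := hp
  refine ⟨Formula.iExs Unit (φ.relabel fun k => if k = j then Sum.inr () else Sum.inl k), ?_⟩
  ext i v
  have elim_comp (a : Unit → X i) : (Sum.elim v a ∘
      fun k => if k = j then Sum.inr () else Sum.inl k) = update v j (a ()) := by
    ext k
    by_cases hk : k = j <;> simp [hk]
  simp only [den, ex, Formula.realize_iExs, Formula.realize_relabel, elim_comp]
  exact ⟨fun ⟨a, ha⟩ => ⟨a (), ha⟩, fun ⟨a, ha⟩ => ⟨fun _ => a, ha⟩⟩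

theorem ex_mem_definableOn {p : UniformPred X} {j : ℕ} {D : Set ℕ}
    (hp : p ∈ definableOn L X (insert j D)) : ex j p ∈ definableOn L X D :=
  ⟨ex_mem_definable j hp.1, ex_mem_dependingOn hp.2⟩

theorem definableOn_mono {D D' : Set ℕ} (h : D ⊆ D') : definableOn L X D ≤ definableOn L X D' :=
  fun _ hp => ⟨hp.1, dependingOn_mono h hp.2⟩

theorem exists_formula_of_mem_definableOn_range [∀ i, Nonempty (X i)] {α : Type*} {f : α → ℕ}
    {p : UniformPred X} (hp : p ∈ definableOn L X (Set.range f)) :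
    ∃ χ : L.Formula α, ∀ i v, χ.Realize (v ∘ f) ↔ p i v := by
  classical
  obtain ⟨⟨φ, rfl⟩, hf⟩ := hp
  refine ⟨Formula.iExs Unit (φ.relabel fun k =>
    if h : ∃ a, f a = k then Sum.inl h.choose else Sum.inr ()), fun i v => ?_⟩
  have realize_iff (x : Unit → X i) : φ.Realize (Sum.elim (v ∘ f) x ∘ fun k =>
      if h : ∃ a, f a = k then Sum.inl h.choose else Sum.inr ()) ↔ φ.Realize v := by
    refine iff_of_eq (hf i fun k (h : ∃ a, f a = k) => ?_)
    simp only [comp_apply, dif_pos h, Sum.elim_inl, h.choose_spec]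
  simp only [Formula.realize_iExs, Formula.realize_relabel, realize_iff, exists_const]
  rfl

theorem exists_fin_formula_of_mem_definableOn [∀ i, Nonempty (X i)] {p : UniformPred X}
    {D : Finset ℕ} (hp : p ∈ definableOn L X D) : ∃ (k : ℕ) (f : Fin k → ℕ) (χ : L.Formula (Fin k)),
      Set.range f = D ∧ p = fun _ v => χ.Realize (v ∘ f) := by
  have range_eq := D.range_orderEmbOfFin rfl
  rw [← range_eq] at hp
  obtain ⟨χ, hχ⟩ := exists_formula_of_mem_definableOn_range hp
  exact ⟨_, _, χ, range_eq, funext₂ fun i v => propext (hχ i v).symm⟩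

theorem realize_iff_restrictFreeVar {M : Type*} [L.Structure M] (φ : L.Formula ℕ) (v : ℕ → M) :
    φ.Realize v ↔ BoundedFormula.Realize (φ.restrictFreeVar id) (v ∘ (↑)) default :=
  (BoundedFormula.realize_restrictFreeVar (f := id) v fun _ => rfl).symm

theorem exists_finset_mem_definableOn {p : UniformPred X} (hp : p ∈ definable L X) :
    ∃ D : Finset ℕ, p ∈ definableOn L X D := by
  obtain ⟨φ, rfl⟩ := hp
  refine ⟨φ.freeVarFinset, ⟨φ, rfl⟩, fun i v v' h => propext ?_⟩
  have comp_eq : v ∘ ((↑) : φ.freeVarFinset → ℕ) = v' ∘ (↑) := funext fun k => h k k.2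
  rw [den, den, realize_iff_restrictFreeVar, comp_eq, ← realize_iff_restrictFreeVar]

/-- Quantified bound variables are turned into variables from `ℕ` that are not yet in use. -/
theorem boundedFormula_realize_mem [L.IsRelational] {A : BooleanSubalgebra (UniformPred X)}
    (ex : ∀ j, ∀ p ∈ A, ex j p ∈ A) (eq : ∀ j k, eqVar X j k ∈ A)
    (rel : ∀ (k : ℕ) (R : L.Relations k) (f : Fin k → ℕ),
      (fun _ v => Structure.RelMap R (v ∘ f)) ∈ A)
    {α : Type*} [Finite α] {n : ℕ} (φ : L.BoundedFormula α n) :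
    ∀ (g : α → ℕ) (h : Fin n → ℕ), (fun _ v => φ.Realize (v ∘ g) (v ∘ h)) ∈ A := by
  have term {n : ℕ} (g : α → ℕ) (h : Fin n → ℕ) (t : L.Term (α ⊕ Fin n)) : ∃ j : ℕ,
      ∀ (i : I) (v : ℕ → X i), t.realize (Sum.elim (v ∘ g) (v ∘ h)) = v j := by
    cases t with
    | var a => exact ⟨Sum.elim g h a, fun i v => by cases a <;> rfl⟩
    | func f ts => exact isEmptyElim f
  induction φ with intro g h
  | falsum => exact bot_mem
  | equal t₁ t₂ =>
    obtain ⟨j, hj⟩ := term g h t₁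
    obtain ⟨k, hk⟩ := term g h t₂
    simp only [BoundedFormula.Realize, hj, hk]
    exact eq j k
  | rel R ts =>
    choose f hf using fun i => term g h (ts i)
    simp only [BoundedFormula.Realize, hf]
    exact rel _ R f
  | imp φ₁ φ₂ ih₁ ih₂ => exact himp_mem (ih₁ g h) (ih₂ g h)
  | @all n φ ih =>
    obtain ⟨j, hj⟩ := ((Set.finite_range g).union (Set.finite_range h)).exists_notMem
    have update_comp (i : I) (v : ℕ → X i) (a : X i) : update v j a ∘ g = v ∘ g :=
      funext fun b => update_of_ne (fun e => hj (Or.inl ⟨b, e⟩)) _ _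
    have update_comp_snoc (i : I) (v : ℕ → X i) (a : X i) :
        update v j a ∘ (Fin.snoc h j : Fin (n + 1) → ℕ) = Fin.snoc (v ∘ h) a := by
      rw [Fin.comp_snoc, update_self]
      congr 1
      exact funext fun b => update_of_ne (fun e => hj (Or.inr ⟨b, e⟩)) _ _
    convert compl_mem (ex j _ (compl_mem (ih g (Fin.snoc h j)))) using 1
    ext i v
    simp only [Pi.compl_apply, compl_iff_not, UniformPred.ex, not_exists, not_not, update_comp,
      update_comp_snoc, BoundedFormula.realize_all]

theorem definable_le [L.IsRelational] {A : BooleanSubalgebra (UniformPred X)}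
    (ex : ∀ j, ∀ p ∈ A, ex j p ∈ A) (eq : ∀ j k, eqVar X j k ∈ A)
    (rel : ∀ (k : ℕ) (R : L.Relations k) (f : Fin k → ℕ),
      (fun _ v => Structure.RelMap R (v ∘ f)) ∈ A) : definable L X ≤ A := by
  rintro _ ⟨φ, rfl⟩
  convert boundedFormula_realize_mem ex eq rel (φ.restrictFreeVar id) (↑) default using 1
  ext i v
  exact (realize_iff_restrictFreeVar φ v).trans (iff_of_eq (congrArg _ (Subsingleton.elim _ _)))

end Definable

section ElementaryEquivalence

open Function BooleanSubalgebra UniformPred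

variable {L : FirstOrder.Language} {I : Type*} {X : I → Type*} [∀ i, L.Structure (X i)]

theorem realize_exClosure_iff {M : Type*} [L.Structure M] [Nonempty M] (φ : L.Formula ℕ) :
    M ⊨ φ.exClosure ↔ ∃ v : ℕ → M, φ.Realize v := by
  simp only [Formula.realize_exClosure, realize_iff_restrictFreeVar φ]
  exact (Subtype.val_injective.surjective_comp_right).exists

theorem realize_iff_iff_not_models_exClosure {T : L.Theory} (hT : T.IsComplete) (M : Type*)
    [L.Structure M] [Nonempty M] [M ⊨ T] (φ ψ : L.Formula ℕ) :
    (∀ v : ℕ → M, φ.Realize v ↔ ψ.Realize v) ↔ ¬ T ⊨ᵇ (φ.iff ψ).not.exClosure := by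
  rw [← hT.realize_sentence_iff _ M, realize_exClosure_iff, not_exists]
  exact forall_congr' fun v => by rw [Formula.realize_not, Formula.realize_iff, not_not]

theorem iff_iff_of_isComplete {T : L.Theory} (hT : T.IsComplete) (M : Type*) [L.Structure M]
    [Nonempty M] [M ⊨ T] {φ ψ : L.Formula ℕ} :
    (φ ⇔[T] ψ) ↔ ∀ v : ℕ → M, φ.Realize v ↔ ψ.Realize v := by
  refine ⟨fun h v => h.realize_iff, fun h N v xs => ?_⟩
  rw [realize_iff_iff_not_models_exClosure hT M, ← realize_iff_iff_not_models_exClosure hT N] at h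
  rw [BoundedFormula.realize_iff, Subsingleton.elim xs default]
  exact h v

variable {i i' : I} [Nonempty (X i)] [Nonempty (X i')] {𝒯 : Set (UniformPred X)}

theorem exists_sameType_of_elementarilyEquivalent (h : X i ≅[L] X i') (hfin : 𝒯.Finite)
    (h𝒯 : 𝒯 ⊆ definable L X) (v : ℕ → X i) : ∃ v' : ℕ → X i', SameType 𝒯 v v' := by
  obtain ⟨φ, hφ⟩ := exactly_mem hfin h𝒯 (Set.sep_subset 𝒯 fun p => p i v)
  have : X i ⊨ φ.exClosure := (realize_exClosure_iff φ).2 ⟨v, by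
    rw [← den, hφ]
    exact exactly_setOf i v⟩
  obtain ⟨v', hv'⟩ := (realize_exClosure_iff φ).1 ((h.realize_sentence _).1 this)
  rw [← den, hφ] at hv'
  exact ⟨v', sameType_of_exactly (exactly_setOf i v) hv'⟩

theorem exists_sameType_const_of_elementarilyEquivalent (h : X i ≅[L] X i') (hfin : 𝒯.Finite)
    (h𝒯 : 𝒯 ⊆ definable L X) (a : X i) :
    ∃ a' : X i', SameType 𝒯 (fun _ => a) (fun _ => a') := by
  obtain ⟨v', hv'⟩ := exists_sameType_of_elementarilyEquivalent h (hfin.image (subst fun _ => 0))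
    (Set.image_subset_iff.2 fun p hp => subst_mem_definable (h𝒯 hp) _) fun _ => a
  exact ⟨v' 0, fun p hp => hv' _ (Set.mem_image_of_mem _ hp)⟩

end ElementaryEquivalence

/-! ### Outer and inner predicates -/

section Product

open Function UniformPred
open BooleanSubalgebra hiding closure subset_closure

variable {L₁ L₂ : FirstOrder.Language} {I : Type*} {M N : I → Type*}

/-- The predicates of the `M i`, applied to the first coordinates of assignments in `M i × N i`. -/
abbrev outer : BoundedLatticeHom (UniformPred M) (UniformPred fun i => M i × N i) :=
  comap fun _ v => Prod.fst ∘ v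

/-- The variables in `D` have the same first coordinate, and the second coordinates satisfy `q`. -/
def inner (D : Finset ℕ) (q : UniformPred N) : UniformPred fun i => M i × N i :=
  fun i v => (∀ k ∈ D, ∀ l ∈ D, (v k).1 = (v l).1) ∧ q i (Prod.snd ∘ v)

/-- The outer predicates coming from `𝒜` and the inner predicates coming from `ℬ`. -/
def outerInner (𝒜 : Set (UniformPred M)) (ℬ : Set (Finset ℕ × UniformPred N)) :
    Set (UniformPred fun i => M i × N i) :=
  outer '' 𝒜 ∪ uncurry inner '' ℬ

theorem inner_mem_dependingOn {D : Finset ℕ} {q : UniformPred N} (hq : q ∈ dependingOn N D) :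
    (inner D q : UniformPred fun i => M i × N i) ∈ dependingOn _ D := by
  intro i v v' h
  have fst_iff : (∀ k ∈ D, ∀ l ∈ D, (v k).1 = (v l).1) ↔ ∀ k ∈ D, ∀ l ∈ D, (v' k).1 = (v' l).1 :=
    forall₄_congr fun k hk l hl => by rw [h k hk, h l hl]
  exact congrArg₂ And (propext fst_iff) (hq i fun k hk => congrArg Prod.snd (h k hk))

theorem inner_iff_of_forall_fst_eq {D : Finset ℕ} {q : UniformPred N} {i : I} {v : ℕ → M i × N i}
    {a : M i} (h : ∀ k ∈ D, (v k).1 = a) : inner D q i v ↔ q i (Prod.snd ∘ v) :=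
  and_iff_right fun k hk l hl => (h k hk).trans (h l hl).symm

theorem inner_iff_of_range_eq {D : Finset ℕ} {α : Type*} {f : α → ℕ} (hf : Set.range f = D)
    {q : UniformPred N} {i : I} {v : ℕ → M i × N i} :
    inner D q i v ↔ (∀ a b, (v (f a)).1 = (v (f b)).1) ∧ q i (Prod.snd ∘ v) := by
  simp only [inner, ← Finset.mem_coe, ← hf, Set.forall_mem_range]

theorem exists_finite_subset_outerInner {𝒜 : Set (UniformPred M)}
    {ℬ : Set (Finset ℕ × UniformPred N)} {𝒯 : Set (UniformPred fun i => M i × N i)}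
    (h𝒯 : 𝒯 ⊆ outerInner 𝒜 ℬ) (hfin : 𝒯.Finite) :
    ∃ 𝒜' ⊆ 𝒜, ∃ ℬ' ⊆ ℬ, 𝒜'.Finite ∧ ℬ'.Finite ∧ 𝒯 ⊆ outerInner 𝒜' ℬ' := by
  obtain ⟨𝒜', h𝒜', hfin𝒜, h⟩ := Set.exists_subset_image_finite_and.1
    ⟨𝒯 ∩ outer '' 𝒜, Set.inter_subset_right, hfin.inter_of_left _, rfl⟩
  obtain ⟨ℬ', hℬ', hfinℬ, h'⟩ := Set.exists_subset_image_finite_and.1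
    ⟨𝒯 ∩ uncurry inner '' ℬ, Set.inter_subset_right, hfin.inter_of_left _, rfl⟩
  refine ⟨𝒜', h𝒜', ℬ', hℬ', hfin𝒜, hfinℬ, ?_⟩
  rw [outerInner, ← h, ← h', ← Set.inter_union_distrib_left]
  exact Set.subset_inter subset_rfl h𝒯

theorem sameType_outerInner {𝒜 : Set (UniformPred M)} {ℬ : Set (Finset ℕ × UniformPred N)}
    {i i' : I} {v : ℕ → M i × N i} {v' : ℕ → M i' × N i'} :
    SameType (outerInner 𝒜 ℬ) v v' ↔ SameType 𝒜 (Prod.fst ∘ v) (Prod.fst ∘ v') ∧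
      ∀ D q, (D, q) ∈ ℬ → (inner D q i v ↔ inner D q i' v') := by
  simp only [SameType, outerInner, Set.mem_union, or_imp, forall_and, Set.forall_mem_image,
    Prod.forall, uncurry_apply_pair]
  rfl

/-- The equalities between the variables in `V`. -/
def eqVars (X : I → Type*) (V : Finset ℕ) : Set (UniformPred X) :=
  Set.image2 (eqVar X) V V

theorem UniformPred.SameType.eq_iff {X : I → Type*} {V : Finset ℕ} {i i' : I} {v : ℕ → X i}
    {v' : ℕ → X i'} (h : SameType (eqVars X V) v v') {k l : ℕ} (hk : k ∈ V) (hl : l ∈ V) :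
    v k = v l ↔ v' k = v' l :=
  h _ (Set.mem_image2_of_mem hk hl)

section BackAndForth

variable {i i' : I} {v : ℕ → M i × N i} {v' : ℕ → M i' × N i'} {j : ℕ} {V : Finset ℕ}
  {x : M i × N i} {x' : M i' × N i'}

theorem inner_update_iff {C : Finset ℕ} {q : UniformPred N} (hq : q ∈ dependingOn N C) (hCV : C ⊆ V)
    (hv : inner C q i v ↔ inner C q i' v')
    (hfst : SameType (eqVars M V) (Prod.fst ∘ update v j x) (Prod.fst ∘ update v' j x'))
    (hsnd : (∀ k ∈ C, k ≠ j → (v k).1 = x.1) →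
      (q i (Prod.snd ∘ update v j x) ↔ q i' (Prod.snd ∘ update v' j x'))) :
    inner C q i (update v j x) ↔ inner C q i' (update v' j x') := by
  by_cases hj : j ∈ C
  · have fst_iff : (∀ k ∈ C, ∀ l ∈ C, (update v j x k).1 = (update v j x l).1) ↔
        ∀ k ∈ C, ∀ l ∈ C, (update v' j x' k).1 = (update v' j x' l).1 :=
      forall₄_congr fun k hk l hl => hfst.eq_iff (hCV hk) (hCV hl)
    rw [inner, inner, ← fst_iff]
    refine and_congr_right fun h => hsnd fun k hk hkj => ?_
    simpa only [update_self, update_of_ne hkj] using h k hk j hj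
  · have update_iff {i : I} (v : ℕ → M i × N i) (x : M i × N i) :
        inner C q i (update v j x) ↔ inner C q i v :=
      iff_of_eq (inner_mem_dependingOn hq i fun k hk =>
        update_of_ne (ne_of_mem_of_not_mem hk hj) _ _)
    rw [update_iff, update_iff, hv]

/-- The second coordinate of the new element is chosen relative to the set `D` of the variables
that share its first coordinate: only these can occur together with it in a true inner
predicate. -/
theorem exists_sameType_outerInner_update {𝒜 : Set (UniformPred M)}
    {ℬ : Set (Finset ℕ × UniformPred N)} (hℬ : ∀ b ∈ ℬ, b.2 ∈ dependingOn N b.1) (hjV : j ∈ V)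
    (hV : ∀ b ∈ ℬ, b.1 ⊆ V) (hinner : ∀ C q, (C, q) ∈ ℬ → (inner C q i v ↔ inner C q i' v'))
    {a' : M i'} (hfst : SameType (𝒜 ∪ eqVars M V) (update (Prod.fst ∘ v) j x.1)
      (update (Prod.fst ∘ v') j a'))
    (hback : ∀ D ⊆ V, (∀ k ∈ D, (v k).1 = x.1) → (∀ k ∈ D, (v' k).1 = a') → ∃ b',
      SameType {q | ∃ C ⊆ insert j D, (C, q) ∈ ℬ} (update (Prod.snd ∘ v) j x.2)
        (update (Prod.snd ∘ v') j b')) :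
    ∃ x', SameType (outerInner 𝒜 ℬ) (update v j x) (update v' j x') := by
  classical
  have hfst_eq : SameType (eqVars M V) _ _ := hfst.mono Set.subset_union_right
  let D : Finset ℕ := {k ∈ V.erase j | (v k).1 = x.1}
  have hDV : D ⊆ V := (Finset.filter_subset _ _).trans (V.erase_subset j)
  have hD : ∀ k ∈ D, (v k).1 = x.1 := fun k hk => (Finset.mem_filter.1 hk).2
  have hD' : ∀ k ∈ D, (v' k).1 = a' := fun k hk => by
    have eq_iff := hfst_eq.eq_iff (hDV hk) hjV
    have hkj : k ≠ j := Finset.ne_of_mem_erase (Finset.mem_filter.1 hk).1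
    simp only [update_self, update_of_ne hkj] at eq_iff
    exact eq_iff.1 (hD k hk)
  obtain ⟨b', hb'⟩ := hback D hDV hD hD'
  refine ⟨(a', b'), sameType_outerInner.2 ⟨?_, fun C q hCq => ?_⟩⟩
  · simpa only [comp_update] using hfst.mono Set.subset_union_left
  · refine inner_update_iff (hℬ _ hCq) (hV _ hCq) (hinner C q hCq)
      (by simpa only [comp_update] using hfst_eq) fun hC => ?_
    simp only [comp_update]
    refine hb' q ⟨C, fun k hk => Finset.mem_insert.2 (or_iff_not_imp_left.2 fun hkj => ?_), hCq⟩
    exact Finset.mem_filter.2 ⟨Finset.mem_erase.2 ⟨hkj, hV _ hCq hk⟩, hC k hk hkj⟩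

end BackAndForth

variable [∀ i, L₁.Structure (M i)] [∀ i, L₂.Structure (N i)]

theorem exists_finite_backAndForth_inner (j : ℕ) {ℬ : Set (Finset ℕ × UniformPred N)}
    (hℬ : ∀ b ∈ ℬ, b.2 ∈ definableOn L₂ N b.1) (hfin : ℬ.Finite) (D : Finset ℕ) :
    ∃ 𝒬 : Set (UniformPred N), 𝒬.Finite ∧ 𝒬 ⊆ definableOn L₂ N D ∧
      ∀ i i' (w : ℕ → N i) (w' : ℕ → N i'), SameType 𝒬 w w' → ∀ b, ∃ b',
        SameType {q | ∃ C ⊆ insert j D, (C, q) ∈ ℬ} (update w j b) (update w' j b') := by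
  refine exists_finite_backAndForth (fun _ => ex_mem_definableOn)
    ((hfin.image Prod.snd).subset ?_) ?_
  · rintro q ⟨C, -, hq⟩
    exact ⟨(C, q), hq, rfl⟩
  · rintro q ⟨C, hC, hq⟩
    exact definableOn_mono (by exact_mod_cast hC) (hℬ _ hq)

theorem exists_finite_backAndForth_outerInner (j : ℕ) {𝒜 : Set (UniformPred M)}
    {ℬ : Set (Finset ℕ × UniformPred N)} (h𝒜 : 𝒜 ⊆ definable L₁ M) (hfin𝒜 : 𝒜.Finite)
    (hℬ : ∀ b ∈ ℬ, b.2 ∈ definableOn L₂ N b.1) (hfinℬ : ℬ.Finite) :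
    ∃ (𝒜' : Set (UniformPred M)) (ℬ' : Set (Finset ℕ × UniformPred N)), 𝒜' ⊆ definable L₁ M ∧
      (∀ b ∈ ℬ', b.2 ∈ definableOn L₂ N b.1) ∧ 𝒜'.Finite ∧ ℬ'.Finite ∧
      ∀ i i' (v : ℕ → M i × N i) (v' : ℕ → M i' × N i'), SameType (outerInner 𝒜' ℬ') v v' →
        ∀ x, ∃ x', SameType (outerInner 𝒜 ℬ) (update v j x) (update v' j x') := by
  obtain ⟨V, hjV, hV⟩ : ∃ V : Finset ℕ, j ∈ V ∧ ∀ b ∈ ℬ, b.1 ⊆ V :=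
    ⟨insert j (hfinℬ.toFinset.sup Prod.fst), Finset.mem_insert_self _ _, fun b hb =>
      (Finset.le_sup (f := Prod.fst) (hfinℬ.mem_toFinset.2 hb)).trans (Finset.subset_insert _ _)⟩
  obtain ⟨𝒜', hfin𝒜', h𝒜', hback𝒜⟩ := exists_finite_backAndForth (fun _ => ex_mem_definable j)
    (hfin𝒜.union (V.finite_toSet.image2 (eqVar M) V.finite_toSet)) (Set.union_subset h𝒜
      (Set.image2_subset_iff.2 fun k _ l _ => eq_mem_definable k l))
  choose 𝒬 hfin𝒬 h𝒬 hback𝒬 using exists_finite_backAndForth_inner j hℬ hfinℬ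
  refine ⟨𝒜', ℬ ∪ ⋃ D ∈ V.powerset, Prod.mk D '' 𝒬 D, h𝒜', ?_, hfin𝒜', hfinℬ.union
    (V.powerset.finite_toSet.biUnion fun D _ => (hfin𝒬 D).image _), fun i i' v v' h x => ?_⟩
  · rintro b (hb | hb)
    · exact hℬ b hb
    · simp only [Set.mem_iUnion₂] at hb
      obtain ⟨D, -, q, hq, rfl⟩ := hb
      exact h𝒬 D hq
  · obtain ⟨hfst, hinner⟩ := sameType_outerInner.1 h
    obtain ⟨a', ha'⟩ := hback𝒜 i i' _ _ hfst x.1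
    refine exists_sameType_outerInner_update (fun b hb => (hℬ b hb).2) hjV hV
      (fun C q hCq => hinner C q (Or.inl hCq)) ha' fun D hDV hD hD' =>
        hback𝒬 D i i' _ _ (fun q hq => ?_) x.2
    rw [← inner_iff_of_forall_fst_eq (q := q) hD, ← inner_iff_of_forall_fst_eq (q := q) hD']
    exact hinner D q (Or.inr (Set.mem_biUnion (Finset.mem_powerset.2 hDV)
      (Set.mem_image_of_mem _ hq)))

variable (L₁ L₂ M N) in
/-- The predicates on `M i × N i` that are the building blocks for the definable predicates of a
composition: the outer and the inner predicates that come from definable predicates. -/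
def basic : Set (UniformPred fun i => M i × N i) :=
  outerInner (definable L₁ M) {b | b.2 ∈ definableOn L₂ N b.1}

theorem outer_mem_basic {p : UniformPred M} (hp : p ∈ definable L₁ M) :
    outer p ∈ basic L₁ L₂ M N :=
  Or.inl (Set.mem_image_of_mem _ hp)

theorem inner_mem_basic {D : Finset ℕ} {q : UniformPred N} (hq : q ∈ definableOn L₂ N D) :
    inner D q ∈ basic L₁ L₂ M N :=
  Or.inr ⟨(D, q), hq, rfl⟩

theorem inner_range_mem_closure_basic {α : Type*} [Finite α] {f : α → ℕ} {q : UniformPred N}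
    (hq : q ∈ definableOn L₂ N (Set.range f)) :
    (fun i v => (∀ a b, (v (f a)).1 = (v (f b)).1) ∧ q i (Prod.snd ∘ v)) ∈
      BooleanSubalgebra.closure (basic L₁ L₂ M N) := by
  classical
  cases nonempty_fintype α
  have range_eq : Set.range f = (Finset.univ.image f : Finset ℕ) := by simp
  simp only [← inner_iff_of_range_eq range_eq]
  exact BooleanSubalgebra.subset_closure (inner_mem_basic (range_eq ▸ hq))

theorem ex_mem_closure_basic (j : ℕ) {s : UniformPred fun i => M i × N i}
    (hs : s ∈ BooleanSubalgebra.closure (basic L₁ L₂ M N)) :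
    ex j s ∈ BooleanSubalgebra.closure (basic L₁ L₂ M N) := by
  refine ex_mem_closure (fun 𝒯 h𝒯 hfin => ?_) hs
  obtain ⟨𝒜, h𝒜, ℬ, hℬ, hfin𝒜, hfinℬ, hsub⟩ := exists_finite_subset_outerInner h𝒯 hfin
  obtain ⟨𝒜', ℬ', h𝒜', hℬ', hfin𝒜', hfinℬ', hback⟩ :=
    exists_finite_backAndForth_outerInner j h𝒜 hfin𝒜 hℬ hfinℬ
  refine ⟨outerInner 𝒜' ℬ', Set.union_subset_union (Set.image_mono h𝒜') (Set.image_mono hℬ'),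
    (hfin𝒜'.image _).union (hfinℬ'.image _), fun i i' v v' h a => ?_⟩
  obtain ⟨a', ha'⟩ := hback i i' v v' h a
  exact ⟨a', ha'.mono hsub⟩

variable (L₁) in
theorem eqVar_mem_closure_basic (j k : ℕ) :
    eqVar (fun i => M i × N i) j k ∈ BooleanSubalgebra.closure (basic L₁ L₂ M N) := by
  have eqVar_eq : eqVar (fun i => M i × N i) j k = inner {j, k} (eqVar N j k) := by
    ext i v
    simp [eqVar, inner, Prod.ext_iff, eq_comm (a := (v k).1)]
  rw [eqVar_eq]
  refine BooleanSubalgebra.subset_closure (inner_mem_basic ⟨eq_mem_definable j k, ?_⟩)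
  exact fun i v v' h => congrArg₂ Eq (h j (by simp)) (h k (by simp))

variable {L : FirstOrder.Language} [∀ i, L.Structure (M i × N i)]

theorem definable_le_closure_basic [L.IsRelational]
    (rel : ∀ (k : ℕ) (R : L.Relations k) (f : Fin k → ℕ),
      (fun _ v => Structure.RelMap R (v ∘ f)) ∈ BooleanSubalgebra.closure (basic L₁ L₂ M N)) :
    definable L (fun i => M i × N i) ≤ BooleanSubalgebra.closure (basic L₁ L₂ M N) :=
  definable_le (fun j _ => ex_mem_closure_basic j) (eqVar_mem_closure_basic L₁) rel

theorem elementarilyEquivalent_prod {i i' : I} [Nonempty (M i)] [Nonempty (M i')] [Nonempty (N i)]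
    [Nonempty (N i')] (hM : M i ≅[L₁] M i') (hN : N i ≅[L₂] N i')
    (h : definable L (fun i => M i × N i) ≤ BooleanSubalgebra.closure (basic L₁ L₂ M N)) :
    (M i × N i) ≅[L] (M i' × N i') := by
  refine elementarilyEquivalent_iff.2 fun φ => ?_
  obtain ⟨𝒯, h𝒯, hfin, hφ⟩ := exists_finite_sameType_of_mem_closure
    (h (realize_comp_mem_definable φ Empty.elim))
  obtain ⟨𝒜, h𝒜, ℬ, hℬ, hfin𝒜, hfinℬ, hsub⟩ := exists_finite_subset_outerInner h𝒯 hfin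
  obtain ⟨a⟩ := ‹Nonempty (M i)›
  obtain ⟨b⟩ := ‹Nonempty (N i)›
  obtain ⟨a', ha'⟩ := exists_sameType_const_of_elementarilyEquivalent hM hfin𝒜 h𝒜 a
  obtain ⟨b', hb'⟩ := exists_sameType_const_of_elementarilyEquivalent hN
    (hfinℬ.image Prod.snd) (Set.image_subset_iff.2 fun b hb => (hℬ hb).1) b
  have sameType : SameType (outerInner 𝒜 ℬ) (fun _ => (a, b)) (fun _ => (a', b')) := by
    refine sameType_outerInner.2 ⟨ha', fun D q hq => ?_⟩
    rw [inner_iff_of_forall_fst_eq fun _ _ => rfl, inner_iff_of_forall_fst_eq fun _ _ => rfl]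
    exact hb' q (Set.mem_image_of_mem Prod.snd hq)
  simpa only [Sentence.Realize, Subsingleton.elim _ (default : Empty → _)] using
    hφ i i' _ _ (sameType.mono hsub)

/-- The predicates `q` of the `N i` that agree, on the assignments with constant first coordinate,
with some member of `A`. -/
def fiberwise (A : BooleanSubalgebra (UniformPred fun i => M i × N i)) :
    BooleanSubalgebra (UniformPred N) where
  carrier := {q | ∃ s ∈ A, ∀ i v, (∀ k l, (v k).1 = (v l).1) → (s i v ↔ q i (Prod.snd ∘ v))}
  supClosed' := by
    rintro q ⟨s, hs, hsq⟩ q' ⟨s', hs', hsq'⟩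
    exact ⟨s ⊔ s', sup_mem hs hs', fun i v h => or_congr (hsq i v h) (hsq' i v h)⟩
  infClosed' := by
    rintro q ⟨s, hs, hsq⟩ q' ⟨s', hs', hsq'⟩
    exact ⟨s ⊓ s', inf_mem hs hs', fun i v h => and_congr (hsq i v h) (hsq' i v h)⟩
  compl_mem' := by
    rintro q ⟨s, hs, hsq⟩
    exact ⟨sᶜ, compl_mem hs, fun i v h => not_congr (hsq i v h)⟩
  bot_mem' := ⟨⊥, bot_mem, fun _ _ _ => Iff.rfl⟩

/-- The first coordinates become constant by retracting all variables onto `D`. -/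
theorem inner_mem_of_mem_fiberwise {A : BooleanSubalgebra (UniformPred fun i => M i × N i)}
    (subst_mem : ∀ f, ∀ p ∈ A, subst f p ∈ A) (eq : ∀ j k, outer (eqVar M j k) ∈ A)
    {D : Finset ℕ} {q : UniformPred N} (hq : q ∈ fiberwise A) (hqD : q ∈ dependingOn N D) :
    inner D q ∈ A := by
  obtain ⟨s, hs, hsq⟩ := hq
  obtain ⟨d, hd⟩ : ∃ d, ∀ k ∈ D, d ∈ D :=
    D.eq_empty_or_nonempty.elim (fun h => ⟨0, by simp [h]⟩) fun ⟨d, hd⟩ => ⟨d, fun _ _ => hd⟩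
  let r (k : ℕ) : ℕ := if k ∈ D then k else d
  have inner_eq : inner D q = (⨅ k ∈ D, ⨅ l ∈ D, outer (eqVar M k l)) ⊓ subst r s := by
    ext i v
    simp only [inner, Pi.inf_apply, iInf_apply, iInf_Prop_eq, inf_Prop_eq]
    refine and_congr_right fun h => ?_
    have fst_eq (k : ℕ) : (v (r k)).1 = (v d).1 := by
      by_cases hk : k ∈ D
      · simpa only [r, if_pos hk] using h k hk d (hd k hk)
      · simp only [r, if_neg hk]
    refine Iff.trans (iff_of_eq (hqD i fun k hk => ?_))
      (hsq i (v ∘ r) fun k l => (fst_eq k).trans (fst_eq l).symm).symm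
    exact congrArg (fun k => (v k).2) (if_pos (Finset.mem_coe.1 hk)).symm
  rw [inner_eq]
  exact inf_mem (biInf_mem D.finite_toSet fun k _ => biInf_mem D.finite_toSet fun l _ => eq k l)
    (subst_mem r s hs)

theorem outer_ex [∀ i, Nonempty (N i)] (j : ℕ) (p : UniformPred M) :
    (outer (ex j p) : UniformPred fun i => M i × N i) = ex j (outer p) := by
  ext i v
  simp [outer, ex, UniformPred.comap, comp_update]

theorem definable_le_comap_outer [L₁.IsRelational] [∀ i, Nonempty (N i)]
    (eq : ∀ j k, outer (eqVar M j k) ∈ definable L (fun i => M i × N i))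
    (rel : ∀ (k : ℕ) (R : L₁.Relations k) (f : Fin k → ℕ),
      (fun _ v => Structure.RelMap R (Prod.fst ∘ v ∘ f)) ∈ definable L (fun i => M i × N i)) :
    definable L₁ M ≤ (definable L (fun i => M i × N i)).comap outer := by
  refine definable_le (fun j p hp => ?_) eq rel
  rw [mem_comap, outer_ex]
  exact ex_mem_definable j hp

theorem definable_le_fiberwise [L₂.IsRelational]
    (eq : ∀ j k, outer (eqVar M j k) ∈ definable L (fun i => M i × N i))
    (rel : ∀ (k : ℕ) (R : L₂.Relations k) (f : Fin k → ℕ),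
      (fun _ v => (∀ a b, (v (f a)).1 = (v (f b)).1) ∧ Structure.RelMap R (Prod.snd ∘ v ∘ f)) ∈
        definable L (fun i => M i × N i)) :
    definable L₂ N ≤ fiberwise (definable L (fun i => M i × N i)) := by
  refine definable_le ?_ ?_ ?_
  · rintro j q ⟨s, hs, hsq⟩
    refine ⟨ex j (outer (eqVar M j (j + 1)) ⊓ s), ex_mem_definable j (inf_mem (eq _ _) hs), ?_⟩
    have fst_eq {i : I} {v : ℕ → M i × N i} (hv : ∀ k l, (v k).1 = (v l).1) {x : M i × N i}
        (hx : x.1 = (v (j + 1)).1) (k : ℕ) : (update v j x k).1 = (v (j + 1)).1 := by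
      rcases eq_or_ne k j with rfl | hkj
      · rwa [update_self]
      · rw [update_of_ne hkj, hv]
    have s_iff {i : I} {v : ℕ → M i × N i} (hv : ∀ k l, (v k).1 = (v l).1) {x : M i × N i}
        (hx : x.1 = (v (j + 1)).1) : s i (update v j x) ↔ q i (update (Prod.snd ∘ v) j x.2) := by
      rw [← comp_update]
      exact hsq i _ fun k l => (fst_eq hv hx k).trans (fst_eq hv hx l).symm
    refine fun i v hv => ⟨fun ⟨x, hx, hs⟩ => ⟨x.2, (s_iff hv ?_).1 hs⟩, fun ⟨b, hb⟩ => ?_⟩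
    · have hx : (update v j x j).1 = (update v j x (j + 1)).1 := hx
      rwa [update_self, update_of_ne j.succ_ne_self] at hx
    · let x := ((v (j + 1)).1, b)
      have hx : x.1 = (v (j + 1)).1 := rfl
      exact ⟨x, (fst_eq hv hx j).trans (fst_eq hv hx (j + 1)).symm, (s_iff hv hx).2 hb⟩
  · refine fun j k => ⟨_, eq_mem_definable j k, fun i v hv => ?_⟩
    exact Prod.ext_iff.trans (and_iff_right (hv j k))
  · exact fun k R f => ⟨_, rel k R f, fun i v hv => and_iff_right fun a b => hv _ _⟩

theorem basic_subset_definable [L₁.IsRelational] [L₂.IsRelational] [∀ i, Nonempty (N i)]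
    (eq : ∀ j k, outer (eqVar M j k) ∈ definable L (fun i => M i × N i))
    (rel₁ : ∀ (k : ℕ) (R : L₁.Relations k) (f : Fin k → ℕ),
      (fun _ v => Structure.RelMap R (Prod.fst ∘ v ∘ f)) ∈ definable L (fun i => M i × N i))
    (rel₂ : ∀ (k : ℕ) (R : L₂.Relations k) (f : Fin k → ℕ),
      (fun _ v => (∀ a b, (v (f a)).1 = (v (f b)).1) ∧ Structure.RelMap R (Prod.snd ∘ v ∘ f)) ∈
        definable L (fun i => M i × N i)) :
    basic L₁ L₂ M N ⊆ definable L (fun i => M i × N i) := by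
  rintro _ (⟨p, hp, rfl⟩ | ⟨⟨D, q⟩, hq, rfl⟩)
  · exact definable_le_comap_outer eq rel₁ hp
  · exact inner_mem_of_mem_fiberwise (fun f p hp => subst_mem_definable hp f) eq
      (definable_le_fiberwise eq rel₂ hq.1) hq.2

end Product

/-! ### Almost `n`-ary structures -/

section AlmostNAry

open Function UniformPred
open BooleanSubalgebra hiding closure subset_closure

variable {L : FirstOrder.Language} {I : Type*} {X : I → Type*} [∀ i, L.Structure (X i)] {n : ℕ}

variable (L X n) in
/-- The definable predicates in `n` variables and the substitution instances of the predicates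
in `Φ`. -/
def generators (Φ : Set (UniformPred X)) : Set (UniformPred X) :=
  (⋃ f : Fin n → ℕ, definableOn L X (Set.range f)) ∪ ⋃ f : ℕ → ℕ, subst f '' Φ

variable (L X n) in
/-- The semantic counterpart of `AlmostNAry`, for the predicates that are uniformly definable in
the structures `X i`; see `isAlmostNAry_of_almostNAry` and `almostNAry_of_isAlmostNAry`. -/
def IsAlmostNAry : Prop :=
  ∃ Φ ⊆ (definable L X : Set (UniformPred X)), Φ.Finite ∧
    definable L X ≤ BooleanSubalgebra.closure (generators L X n Φ)

theorem definableOn_subset_generators (f : Fin n → ℕ) (Φ : Set (UniformPred X)) :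
    (definableOn L X (Set.range f) : Set (UniformPred X)) ⊆ generators L X n Φ :=
  fun _ hp => Or.inl (Set.mem_iUnion_of_mem f hp)

theorem subst_mem_generators {Φ : Set (UniformPred X)} {p : UniformPred X} (hp : p ∈ Φ)
    (f : ℕ → ℕ) : subst f p ∈ generators L X n Φ :=
  Or.inr (Set.mem_iUnion_of_mem f (Set.mem_image_of_mem _ hp))

theorem subst_mem_closure_generators {Φ : Set (UniformPred X)} {p : UniformPred X}
    (hp : p ∈ BooleanSubalgebra.closure (generators L X n Φ)) (f : ℕ → ℕ) :
    subst f p ∈ BooleanSubalgebra.closure (generators L X n Φ) := by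
  refine BooleanSubalgebra.closure_le (L := (BooleanSubalgebra.closure _).comap (subst f)).2
    (fun q hq => BooleanSubalgebra.subset_closure ?_) hp
  rcases hq with hq | hq
  · obtain ⟨g, hg⟩ := Set.mem_iUnion.1 hq
    refine definableOn_subset_generators (f ∘ g) Φ ⟨subst_mem_definable hg.1 f, ?_⟩
    rw [Set.range_comp]
    exact subst_mem_dependingOn hg.2
  · obtain ⟨g, r, hr, rfl⟩ := Set.mem_iUnion.1 hq
    exact subst_mem_generators hr (f ∘ g)

theorem BoolComb.den_mem {Δ : Set (L.Formula ℕ)} {A : BooleanSubalgebra (UniformPred X)}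
    (hΔ : ∀ φ ∈ Δ, den X φ ∈ A) {φ : L.Formula ℕ} (hφ : BoolComb Δ φ) : den X φ ∈ A := by
  induction hφ with
  | of φ h => exact hΔ φ h
  | not φ _ ih =>
    convert compl_mem ih using 1
    ext; exact Formula.realize_not
  | and φ ψ _ _ ihφ ihψ =>
    convert inf_mem ihφ ihψ using 1
    ext; exact Formula.realize_inf
  | or φ ψ _ _ ihφ ihψ =>
    convert sup_mem ihφ ihψ using 1
    ext; exact Formula.realize_sup

theorem exists_boolComb_of_mem_closure {Δ : Set (L.Formula ℕ)} (hΔ : Δ.Nonempty)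
    {p : UniformPred X} (hp : p ∈ BooleanSubalgebra.closure (den X '' Δ)) :
    ∃ ψ, BoolComb Δ ψ ∧ den X ψ = p := by
  induction hp using closure_bot_sup_induction with
  | mem p hp =>
    obtain ⟨φ, hφ, rfl⟩ := hp
    exact ⟨φ, .of φ hφ, rfl⟩
  | bot =>
    obtain ⟨φ, hφ⟩ := hΔ
    refine ⟨φ ⊓ φ.not, .and _ _ (.of φ hφ) (.not _ (.of φ hφ)), ?_⟩
    ext
    simp [den, Formula.realize_inf, Formula.realize_not]
  | sup p _ q _ ihp ihq =>
    obtain ⟨φ, hφ, rfl⟩ := ihp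
    obtain ⟨ψ, hψ, rfl⟩ := ihq
    exact ⟨φ ⊔ ψ, .or _ _ hφ hψ, by ext; exact Formula.realize_sup⟩
  | compl p _ ih =>
    obtain ⟨φ, hφ, rfl⟩ := ih
    exact ⟨φ.not, .not _ hφ, by ext; exact Formula.realize_not⟩

theorem den_relabel {α : Type*} (φ : L.Formula α) (f : α → ℕ) :
    den X (φ.relabel f) = fun _ v => φ.Realize (v ∘ f) := by
  ext; exact Formula.realize_relabel

variable {M : Type*} [L.Structure M] [Nonempty M] {T : L.Theory} [M ⊨ T]

variable (M) in
theorem iff_iff_den_eq (hT : T.IsComplete) {φ ψ : L.Formula ℕ} :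
    (φ ⇔[T] ψ) ↔ den (fun _ : Unit => M) φ = den _ ψ := by
  rw [iff_iff_of_isComplete hT M]
  exact ⟨fun h => funext₂ fun _ v => propext (h v), fun h v => iff_of_eq (congrFun₂ h () v)⟩

theorem isAlmostNAry_of_almostNAry (hT : T.IsComplete) (h : AlmostNAry n T) :
    IsAlmostNAry L (fun _ : Unit => M) n := by
  obtain ⟨m, k, φ, h⟩ := h
  refine ⟨Set.range fun i _ v => (φ i).Realize (v ∘ Fin.val), ?_, Set.finite_range _, ?_⟩
  · rintro _ ⟨i, rfl⟩
    exact realize_comp_mem_definable (φ i) Fin.val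
  · rintro _ ⟨χ, rfl⟩
    obtain ⟨ψ, hψ, hχψ⟩ := h χ
    rw [(iff_iff_den_eq M hT).1 hχψ]
    refine hψ.den_mem fun θ hθ => ?_
    rcases hθ with ⟨θ', hθ', hθθ'⟩ | hθ
    · rw [(iff_iff_den_eq M hT).1 hθθ']
      refine hθ'.den_mem fun ξ hξ => BooleanSubalgebra.subset_closure ?_
      obtain ⟨ξ, f, rfl⟩ := Set.mem_iUnion.1 hξ
      rw [den_relabel]
      exact definableOn_subset_generators f _ (realize_comp_mem_definableOn ξ f)
    · obtain ⟨i, f, rfl⟩ := Set.mem_iUnion.1 hθ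
      rw [den_relabel, ← extend_comp Fin.val_injective f 0]
      exact BooleanSubalgebra.subset_closure (subst_mem_generators (Set.mem_range_self i) _)

theorem almostNAry_of_isAlmostNAry (hT : T.IsComplete)
    (h : IsAlmostNAry L (fun _ : Unit => M) n) : AlmostNAry n T := by
  obtain ⟨Φ, hΦ, hfin, h⟩ := h
  obtain ⟨m, p, rfl⟩ := hfin.fin_embedding
  replace hΦ (i : Fin m) : p i ∈ definable L _ := hΦ ⟨i, rfl⟩
  choose D hD using fun i => exists_finset_mem_definableOn (hΦ i)
  obtain ⟨k, hk⟩ := (Finset.univ.biUnion D).exists_nat_subset_range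
  have hp (i : Fin m) : p i ∈ definableOn L _ (Set.range (Fin.val (n := k))) := by
    refine definableOn_mono ?_ (hD i)
    rw [Fin.range_val]
    exact fun j hj => Finset.mem_range.1 (hk (Finset.mem_biUnion.2 ⟨i, Finset.mem_univ i, hj⟩))
  choose φ hφ using fun i => exists_formula_of_mem_definableOn_range (hp i)
  refine ⟨m, k, φ, fun χ => ?_⟩
  have isNFormula (ξ : L.Formula (Fin n)) (f : Fin n → ℕ) : IsNFormula T n (ξ.relabel f) :=
    ⟨_, .of _ (Set.mem_iUnion_of_mem ξ ⟨f, rfl⟩), .refl _⟩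
  have hχ : den _ χ ∈ BooleanSubalgebra.closure
      (den (fun _ : Unit => M) '' ({θ | IsNFormula T n θ} ∪ ⋃ i, substInstances (φ i))) := by
    refine BooleanSubalgebra.closure_mono ?_ (h ⟨χ, rfl⟩)
    rintro q (hq | hq)
    · obtain ⟨f, hq⟩ := Set.mem_iUnion.1 hq
      obtain ⟨ξ, hξ⟩ := exists_formula_of_mem_definableOn_range hq
      refine ⟨ξ.relabel f, Or.inl (isNFormula ξ f), ?_⟩
      rw [den_relabel]
      exact funext₂ fun i v => propext (hξ i v)
    · obtain ⟨f, _, ⟨i, rfl⟩, rfl⟩ := Set.mem_iUnion.1 hq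
      refine ⟨(φ i).relabel (f ∘ Fin.val), Or.inr (Set.mem_iUnion_of_mem i ⟨_, rfl⟩), ?_⟩
      rw [den_relabel]
      exact funext₂ fun j v => propext (hφ i j (v ∘ f))
  obtain ⟨ψ, hψ, hden⟩ := exists_boolComb_of_mem_closure ⟨_, Or.inl (isNFormula ⊥ 0)⟩ hχ
  exact ⟨ψ, hψ, (iff_iff_den_eq M hT).2 hden.symm⟩

end AlmostNAry

section AlmostNAryProduct

open Function UniformPred
open BooleanSubalgebra hiding closure subset_closure

variable {L L₁ L₂ : FirstOrder.Language} {I : Type*} {M N : I → Type*} [∀ i, L₁.Structure (M i)]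
  [∀ i, L₂.Structure (N i)] [∀ i, L.Structure (M i × N i)] {n : ℕ}

theorem outer_mem_dependingOn {p : UniformPred M} {D : Set ℕ} (hp : p ∈ dependingOn M D) :
    (outer p : UniformPred fun i => M i × N i) ∈ dependingOn _ D :=
  fun i _ _ h => hp i fun k hk => congrArg Prod.fst (h k hk)

theorem definable_le_comap_outer_closure_generators {Φ : Set (UniformPred M)}
    {Ψ : Set (UniformPred fun i => M i × N i)}
    (hΦ : definable L₁ M ≤ BooleanSubalgebra.closure (generators L₁ M n Φ))
    (hΨ : ∀ p ∈ Φ, outer p ∈ Ψ) (hbasic : basic L₁ L₂ M N ⊆ definable L (fun i => M i × N i)) :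
    definable L₁ M ≤
      (BooleanSubalgebra.closure (generators L (fun i => M i × N i) n Ψ)).comap outer := by
  refine hΦ.trans (BooleanSubalgebra.closure_le.2 fun p hp => BooleanSubalgebra.subset_closure ?_)
  rcases hp with hp | hp
  · obtain ⟨f, hp⟩ := Set.mem_iUnion.1 hp
    exact definableOn_subset_generators f _
      ⟨hbasic (outer_mem_basic hp.1), outer_mem_dependingOn hp.2⟩
  · obtain ⟨f, q, hq, rfl⟩ := Set.mem_iUnion.1 hp
    exact subst_mem_generators (hΨ q hq) f

theorem definable_le_fiberwise_closure_generators {Φ : Set (UniformPred N)}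
    {Ψ : Set (UniformPred fun i => M i × N i)}
    (hΦ : definable L₂ N ≤ BooleanSubalgebra.closure (generators L₂ N n Φ))
    (hΨ : ∀ q ∈ Φ, ∃ D, inner D q ∈ Ψ)
    (hbasic : basic L₁ L₂ M N ⊆ definable L (fun i => M i × N i)) :
    definable L₂ N ≤
      fiberwise (BooleanSubalgebra.closure (generators L (fun i => M i × N i) n Ψ)) := by
  classical
  refine hΦ.trans (BooleanSubalgebra.closure_le.2 fun p hp => ?_)
  rcases hp with hp | hp
  · obtain ⟨f, hp⟩ := Set.mem_iUnion.1 hp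
    replace hp : p ∈ definableOn L₂ N (Finset.univ.image f) := by simpa using hp
    refine ⟨inner (Finset.univ.image f) p, BooleanSubalgebra.subset_closure
      (definableOn_subset_generators f _ ⟨hbasic (inner_mem_basic hp), ?_⟩),
      fun i v h => inner_iff_of_forall_fst_eq fun k _ => h k 0⟩
    simpa using inner_mem_dependingOn hp.2
  · obtain ⟨f, q, hq, rfl⟩ := Set.mem_iUnion.1 hp
    obtain ⟨D, hD⟩ := hΨ q hq
    exact ⟨subst f (inner D q), BooleanSubalgebra.subset_closure (subst_mem_generators hD f),
      fun i v h => inner_iff_of_forall_fst_eq fun k _ => h (f k) 0⟩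

theorem IsAlmostNAry.prod (hM : IsAlmostNAry L₁ M n) (hN : IsAlmostNAry L₂ N n)
    (hbasic : basic L₁ L₂ M N ⊆ definable L (fun i => M i × N i))
    (hdef : definable L (fun i => M i × N i) ≤ BooleanSubalgebra.closure (basic L₁ L₂ M N)) :
    IsAlmostNAry L (fun i => M i × N i) n := by
  obtain ⟨Φ₁, hΦ₁, hfin₁, h₁⟩ := hM
  obtain ⟨Φ₂, hΦ₂, hfin₂, h₂⟩ := hN
  have exists_support (q) (hq : q ∈ Φ₂) : ∃ D : Finset ℕ, q ∈ definableOn L₂ N D :=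
    exists_finset_mem_definableOn (hΦ₂ hq)
  choose! D hD using exists_support
  let Ψ : Set (UniformPred fun i => M i × N i) := outer '' Φ₁ ∪ (fun q => inner (D q) q) '' Φ₂
  have h_outer := definable_le_comap_outer_closure_generators (Ψ := Ψ) h₁
    (fun p hp => Or.inl ⟨p, hp, rfl⟩) hbasic
  have h_inner := definable_le_fiberwise_closure_generators (Ψ := Ψ) h₂
    (fun q hq => ⟨D q, Or.inr ⟨q, hq, rfl⟩⟩) hbasic
  refine ⟨Ψ, ?_, (hfin₁.image _).union (hfin₂.image _),
    hdef.trans (BooleanSubalgebra.closure_le.2 ?_)⟩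
  · rintro _ (⟨p, hp, rfl⟩ | ⟨q, hq, rfl⟩)
    · exact hbasic (outer_mem_basic (hΦ₁ hp))
    · exact hbasic (inner_mem_basic (hD q hq))
  · rintro _ (⟨p, hp, rfl⟩ | ⟨⟨C, q⟩, hq, rfl⟩)
    · exact h_outer hp
    · exact inner_mem_of_mem_fiberwise (fun f p hp => subst_mem_closure_generators hp f)
        (fun j k => h_outer (eq_mem_definable j k)) (h_inner hq.1) hq.2

end AlmostNAryProduct

/-! ### Compositions -/

section Comp

open Function UniformPred
open BooleanSubalgebra hiding closure subset_closure

variable {S : ℕ → Type u} {σ τ : Signature S}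

instance (σ : Signature S) : σ.lang.IsRelational := fun _ => inferInstanceAs (IsEmpty PEmpty)

theorem relMap_comp_mem_closure_basic {L₁ L₂ : FirstOrder.Language} {I : Type*} {M N : I → Type u}
    [∀ i, σ.lang.Structure (M i)] [∀ i, τ.lang.Structure (N i)] [∀ i, L₁.Structure (M i)]
    [∀ i, L₂.Structure (N i)] (h₁ : definable σ.lang M ≤ definable L₁ M)
    (h₂ : definable τ.lang N ≤ definable L₂ N) {k : ℕ}
    (R : (σ.union τ).lang.Relations k) (f : Fin k → ℕ) :
    (fun i v => (compStructure σ τ (M i) (N i)).RelMap R (v ∘ f)) ∈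
      BooleanSubalgebra.closure (basic L₁ L₂ M N) := by
  refine sup_mem (a := fun i v => ∃ h : R.1 ∈ σ k, v ∘ f ∈ outerRel σ (M i) (N i) ⟨R.1, h⟩)
    (b := fun i v => ∃ h : R.1 ∈ τ k, v ∘ f ∈ innerRel τ (M i) (N i) ⟨R.1, h⟩) ?_ ?_
  · by_cases h : R.1 ∈ σ k
    · simp only [h, exists_true_left]
      exact BooleanSubalgebra.subset_closure
        (outer_mem_basic (h₁ (relMap_mem_definable (L := σ.lang) ⟨R.1, h⟩ f)))
    · simp only [h, IsEmpty.exists_iff]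
      exact bot_mem
  · by_cases h : R.1 ∈ τ k
    · simp only [h, exists_true_left]
      exact inner_range_mem_closure_basic ⟨h₂ (relMap_mem_definable (L := τ.lang) ⟨R.1, h⟩ f),
        fun i v v' hv => congrArg _ (funext fun a => hv _ ⟨a, rfl⟩)⟩
    · simp only [h, IsEmpty.exists_iff]
      exact bot_mem

theorem comp_elementarilyEquivalent (M N M' N' : Type u) [σ.lang.Structure M]
    [τ.lang.Structure N] [σ.lang.Structure M'] [τ.lang.Structure N'] [Nonempty M] [Nonempty N]
    [Nonempty M'] [Nonempty N'] (hM : M ≅[σ.lang] M') (hN : N ≅[τ.lang] N') :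
    letI := compStructure σ τ M N
    letI := compStructure σ τ M' N'
    (M × N) ≅[(σ.union τ).lang] (M' × N') := by
  let X (i : Bool) : Type u := cond i M M'
  let Y (i : Bool) : Type u := cond i N N'
  let instX (i) : σ.lang.Structure (X i) := match i with | true => ‹_› | false => ‹_›
  let instY (i) : τ.lang.Structure (Y i) := match i with | true => ‹_› | false => ‹_›
  let instXY (i) : (σ.union τ).lang.Structure (X i × Y i) := compStructure σ τ (X i) (Y i)
  have nonemptyX (i) : Nonempty (X i) := match i with | true => ‹_› | false => ‹_›
  have nonemptyY (i) : Nonempty (Y i) := match i with | true => ‹_› | false => ‹_›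
  exact elementarilyEquivalent_prod (L := (σ.union τ).lang) (M := X) (N := Y) (i := true)
    (i' := false) hM hN
    (definable_le_closure_basic fun _ => relMap_comp_mem_closure_basic le_rfl le_rfl)

theorem DefinableInComp.comp_mem_definable {M N : Type u} [σ.lang.Structure M] [τ.lang.Structure N]
    {α : Type} {s : Set (α → M × N)} (h : DefinableInComp σ τ M N s) (f : α → ℕ) :
    letI := compStructure σ τ M N
    (fun _ v => v ∘ f ∈ s) ∈ definable (σ.union τ).lang (fun _ : Unit => M × N) := by
  let := compStructure σ τ M N
  obtain ⟨φ, rfl⟩ := Set.empty_definable_iff.1 h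
  exact realize_comp_mem_definable φ f

theorem IsEDefComp.almostNAry {n : ℕ} {T₁ T₂ T : RelTheory S} (h : IsEDefComp T₁ T₂ T)
    (h₁ : AlmostNAry n T₁.theory) (h₂ : AlmostNAry n T₂.theory) : AlmostNAry n T.theory := by
  obtain ⟨M, N, _, _, _, _, _, _, rfl, hE, hsep⟩ := h
  let := compStructure T₁.sig T₂.sig M N
  have relMap_mem {k : ℕ} (R : (T₁.sig.union T₂.sig).lang.Relations k) (f : Fin k → ℕ) :=
    relMap_mem_definable (X := fun _ : Unit => M × N) R f
  refine almostNAry_of_isAlmostNAry (M := M × N)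
    (T := (T₁.sig.union T₂.sig).lang.completeTheory (M × N)) (completeTheory.isComplete _ _)
    (IsAlmostNAry.prod (isAlmostNAry_of_almostNAry T₁.complete h₁)
      (isAlmostNAry_of_almostNAry T₂.complete h₂)
      (basic_subset_definable (fun j k => hE.comp_mem_definable ![j, k]) (fun k R f => ?_)
        fun k R f => ?_)
      (definable_le_closure_basic fun _ => relMap_comp_mem_closure_basic le_rfl le_rfl))
  · by_cases hR : R.1 ∈ T₂.sig k
    · exact (hsep k R.1 R.2 hR).1.comp_mem_definable f
    · convert relMap_mem ⟨R.1, Or.inl R.2⟩ f using 3 with _ v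
      exact (relMap_comp_of_left T₁.sig T₂.sig M N R.1 R.2 hR (v ∘ f)).symm
  · by_cases hR : R.1 ∈ T₁.sig k
    · exact (hsep k R.1 hR R.2).2.comp_mem_definable f
    · convert relMap_mem ⟨R.1, Or.inr R.2⟩ f using 3 with _ v
      exact (relMap_comp_of_right T₁.sig T₂.sig M N R.1 hR R.2 (v ∘ f)).symm

end Comp

section Aritizable

open Function UniformPred

theorem almostNAritizable_completeTheory {L : FirstOrder.Language.{u, v}}
    (K : FirstOrder.Language.{max u v, max u v}) {X : Type*} [L.Structure X] [K.Structure X]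
    [Nonempty X] {n : ℕ} (h : IsAlmostNAry (L.sum K) (fun _ : Unit => X) n) :
    AlmostNAritizable n (L.completeTheory X) := by
  refine ⟨K, (L.sum K).completeTheory X, completeTheory.isComplete _ _, ?_,
    almostNAry_of_isAlmostNAry (completeTheory.isComplete _ _) h⟩
  rw [← Theory.model_iff_subset_completeTheory, LHom.onTheory_model]
  exact Theory.model_iff_subset_completeTheory.2 subset_rfl

theorem exists_isAlmostNAry_of_almostNAritizable {L : FirstOrder.Language.{u, v}} {T : L.Theory}
    {n : ℕ} (h : AlmostNAritizable n T) :
    ∃ (L' : FirstOrder.Language.{max u v, max u v}) (φ : L →ᴸ L') (X : Type (max u v))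
      (_ : L.Structure X) (_ : L'.Structure X), φ.IsExpansionOn X ∧ Nonempty X ∧ X ⊨ T ∧
        IsAlmostNAry L' (fun _ : Unit => X) n := by
  obtain ⟨K, T', hT', hTT', h⟩ := h
  obtain ⟨X⟩ := hT'.1
  let := (LHom.sumInl : L →ᴸ L.sum K).reduct X
  exact ⟨L.sum K, LHom.sumInl, X, inferInstance, inferInstance, LHom.isExpansionOn_reduct _ _,
    inferInstance, (LHom.sumInl.onTheory_model T).1 (X.is_model.mono hTT'),
    isAlmostNAry_of_almostNAry hT' h⟩

/-- The relational language whose symbols are the outer and the inner predicates of a composition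
of structures in the languages `L₁` and `L₂`. There is a symbol for each formula and not only for
each relation symbol, since `L₁` and `L₂` may have function symbols. -/
def traceLang (L₁ L₂ : FirstOrder.Language.{u, v}) : FirstOrder.Language.{u, max u v} where
  Functions _ := PEmpty
  Relations k := L₁.Formula (Fin k) ⊕ L₂.Formula (Fin k)

section Trace

variable {L₁ L₂ : FirstOrder.Language.{u, v}}

instance : (traceLang L₁ L₂).IsRelational := fun _ => inferInstanceAs (IsEmpty PEmpty)

/-- The expansion of `M × N` by its outer and inner predicates. -/
instance traceStructure {M N : Type*} [L₁.Structure M] [L₂.Structure N] :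
    (traceLang L₁ L₂).Structure (M × N) where
  funMap := PEmpty.elim
  RelMap R x := R.elim (fun χ => χ.Realize (Prod.fst ∘ x))
    fun χ => (∀ a b, (x a).1 = (x b).1) ∧ χ.Realize (Prod.snd ∘ x)

variable {I : Type*} {M N : I → Type*} [∀ i, L₁.Structure (M i)] [∀ i, L₂.Structure (N i)]

theorem relMap_trace_mem_closure_basic {k : ℕ} (R : (traceLang L₁ L₂).Relations k)
    (f : Fin k → ℕ) : (fun _ v => Structure.RelMap R (v ∘ f)) ∈
      BooleanSubalgebra.closure (basic L₁ L₂ M N) := by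
  rcases R with χ | χ
  · exact BooleanSubalgebra.subset_closure (outer_mem_basic (realize_comp_mem_definable χ f))
  · exact inner_range_mem_closure_basic (realize_comp_mem_definableOn χ f)

theorem basic_subset_definable_trace [∀ i, Nonempty (M i)] [∀ i, Nonempty (N i)] :
    basic L₁ L₂ M N ⊆ definable (traceLang L₁ L₂) fun i => M i × N i := by
  rintro _ (⟨p, hp, rfl⟩ | ⟨⟨D, q⟩, hq, rfl⟩)
  · obtain ⟨D, hD⟩ := exists_finset_mem_definableOn hp
    obtain ⟨k, f, χ, -, rfl⟩ := exists_fin_formula_of_mem_definableOn hD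
    exact relMap_mem_definable (L := traceLang L₁ L₂) (.inl χ) f
  · obtain ⟨k, f, χ, range_eq, rfl⟩ := exists_fin_formula_of_mem_definableOn hq
    have inner_eq : (uncurry inner (D, fun _ v => χ.Realize (v ∘ f)) :
        UniformPred fun i => M i × N i) =
          fun _ v => Structure.RelMap (L := traceLang L₁ L₂) (.inr χ) (v ∘ f) :=
      funext₂ fun _ _ => propext (inner_iff_of_range_eq range_eq)
    rw [inner_eq]
    exact relMap_mem_definable (L := traceLang L₁ L₂) (.inr χ) f

end Trace

theorem IsComp.almostNAritizable {S : ℕ → Type u} {n : ℕ} {T₁ T₂ T : RelTheory S}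
    (h : IsComp T₁ T₂ T) (h₁ : AlmostNAritizable n T₁.theory)
    (h₂ : AlmostNAritizable n T₂.theory) : AlmostNAritizable n T.theory := by
  obtain ⟨M₀, N₀, _, _, _, _, _, _, rfl⟩ := h
  obtain ⟨L₁, φ₁, M, _, _, _, _, _, h₁⟩ := exists_isAlmostNAry_of_almostNAritizable h₁
  obtain ⟨L₂, φ₂, N, _, _, _, _, _, h₂⟩ := exists_isAlmostNAry_of_almostNAritizable h₂
  let := compStructure T₁.sig T₂.sig M N
  have ofComp_eq : (RelTheory.ofComp T₁.sig T₂.sig M₀ N₀).theory =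
      (T₁.sig.union T₂.sig).lang.completeTheory (M × N) :=
    comp_elementarilyEquivalent M₀ N₀ M N (T₁.complete.models_elementarily_equivalent M₀ M)
      (T₂.complete.models_elementarily_equivalent N₀ N)
  have rel {k : ℕ} (R : ((T₁.sig.union T₂.sig).lang.sum (traceLang L₁ L₂)).Relations k)
      (f : Fin k → ℕ) : (fun _ v => Structure.RelMap R (v ∘ f)) ∈
        BooleanSubalgebra.closure (basic L₁ L₂ (fun _ : Unit => M) fun _ : Unit => N) := by
    rcases R with R | R
    · exact relMap_comp_mem_closure_basic (definable_le_of_isExpansionOn φ₁)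
        (definable_le_of_isExpansionOn φ₂) R f
    · exact relMap_trace_mem_closure_basic R f
  refine (congrArg (AlmostNAritizable (L := (T₁.sig.union T₂.sig).lang) n) ofComp_eq).mpr
    (almostNAritizable_completeTheory (L := (T₁.sig.union T₂.sig).lang) (traceLang L₁ L₂)
      (h₁.prod h₂ ?_ ?_))
  · exact basic_subset_definable_trace.trans (definable_le_of_isExpansionOn LHom.sumInr)
  · exact definable_le_closure_basic fun _ => rel

end Aritizable

theorem FiniteComp.of_forall_mem {S : ℕ → Type u}
    {comp : RelTheory S → RelTheory S → RelTheory S → Prop} {P : RelTheory S → Prop}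
    (hcomp : ∀ T₁ T₂ T, comp T₁ T₂ T → P T₁ → P T₂ → P T) {l : List (RelTheory S)}
    {T : RelTheory S} (h : FiniteComp comp l T) (hl : ∀ T' ∈ l, P T') : P T := by
  induction h with
  | single T => exact hl T (List.mem_singleton_self T)
  | comp l₁ l₂ T₁ T₂ T _ _ h ih₁ ih₂ =>
    rw [List.forall_mem_append] at hl
    exact hcomp T₁ T₂ T h (ih₁ hl.1) (ih₂ hl.2)

end AlmostArity

theorem mainTheorem12_general {S : ℕ → Type u} (n : ℕ)
    (l : List (AlmostArity.RelTheory S)) (T : AlmostArity.RelTheory S) :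
    ((∀ T' ∈ l, AlmostArity.AlmostNAry n T'.theory) →
      AlmostArity.FiniteComp AlmostArity.IsEDefComp l T →
        AlmostArity.AlmostNAry n T.theory) ∧
    ((∀ T' ∈ l, AlmostArity.AlmostNAritizable n T'.theory) →
      AlmostArity.FiniteComp AlmostArity.IsComp l T →
        AlmostArity.AlmostNAritizable n T.theory) :=
  ⟨fun hl h => h.of_forall_mem (P := fun T => AlmostArity.AlmostNAry n T.theory)
      (fun _ _ _ h => h.almostNAry) hl,
    fun hl h => h.of_forall_mem (P := fun T => AlmostArity.AlmostNAritizable n T.theory)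
      (fun _ _ _ h => h.almostNAritizable) hl⟩

theorem mainTheorem12 {S : ℕ → Type u} (n : ℕ) (hn : 2 ≤ n)
    (l : List (AlmostArity.RelTheory S)) (T : AlmostArity.RelTheory S) :
    ((∀ T' ∈ l, AlmostArity.AlmostNAry n T'.theory) →
      AlmostArity.FiniteComp AlmostArity.IsEDefComp l T →
        AlmostArity.AlmostNAry n T.theory) ∧
    ((∀ T' ∈ l, AlmostArity.AlmostNAritizable n T'.theory) →
      AlmostArity.FiniteComp AlmostArity.IsComp l T →
        AlmostArity.AlmostNAritizable n T.theory) :=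
  mainTheorem12_general n l T
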